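/- Let $(\Omega,\mathcal F,\mathbb P)$ be a probability space and $L^0$ the space of (a.s. classes of) real random variables. A linear subspace $\mathcal L\subset L^0$ is *admissible* if it is a Banach lattice for the a.s. order and $L^\infty\subset\mathcal L\subset L^1$; then $\mathcal L':=\{Z\in L^0:\mathbb E|XZ|<\infty\ \forall X\in\mathcal L\}$. Let $\mathcal X=\mathcal X_1\times\dots\times\mathcal X_d$ with $\mathcal X_i$ and $\mathcal E$ admissible, and $\mathcal X'=\mathcal X_1'\times\dots\times\mathcal X_d'$. $\sigma(\mathcal X,\mathcal X')$ is the coarsest topology making $X\mapsto\mathbb E[\langle X,Z\rangle]=\sum_i\mathbb E[X_iZ_i]$ continuous for all $Z\in\mathcal X'$, and similarly for $\sigma(\mathcal E,\mathcal E')$. Subscripts $+$ and $++$ denote the a.s. nonnegative and the a.s. strictly positive elements. Let $S:\mathcal X\to\mathcal E$ be nonconstant, nondecreasing and concave with $S(0)=0$, and such that $X\mapsto\mathbb E[S(X)W]$ is $\sigma(\mathcal X,\mathcal X')$-upper semicontinuous for every $W\in\mathcal E'_+$. Let $\mathcal A\subset\mathcal E$ be convex and $\sigma(\mathcal E,\mathcal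 E')$-closed with $0\in\mathcal A$, $\mathcal A+\mathcal E_+\subset\mathcal A$, and $S^{-1}(\mathcal A)$ a nonempty proper subset of $\mathcal X$. Put $\sigma_{\mathcal A}(W)=\inf_{U\in\mathcal A}\mathbb E[UW]$ for $W\in\mathcal E'$, $\operatorname{bar}(\mathcal A)=\{W\in\mathcal E':\sigma_{\mathcal A}(W)>-\infty\}$, and for $Z\in\mathcal X'$ $$\alpha(Z)=\sup_{W\in\operatorname{bar}(\mathcal A)}\Big\{\sigma_{\mathcal A}(W)+\inf_{X\in\mathcal X}\{\mathbb E[\langle X,Z\rangle]-\mathbb E[S(X)W]\}\Big\},$$ and let $\alpha^+(Z)$ be the same supremum taken over $W\in\operatorname{bar}(\mathcal A)\cap(\mathcal E'_{++}\cup\{0\})$. Assume that $(1_BX_1,\dots,1_BX_d)\in\mathcal X$ for all $X\in\mathcal X$, $B\in\mathcal F$, and that $S(X)=\Lambda(X)$ for all $X\in\mathcal X$, where $\Lambda:\mathbb R^d\to\mathbb R$ is nonconstant, nondecreasing and concave with $\Lambda(0)=0$. Let $\Lambda^\bullet(z)=\inf_{x\in\mathbb R^d}\{\langle x,z\rangle-\Lambda(x)\}\in[-\infty,0]$.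 Let $Z\in\mathcal X'_+$ be nonzero, $E_+(Z)=\bigcup_{i=1}^d\{Z_i>0\}$, and $\mathcal W(Z)=\{W\in\operatorname{bar}(\mathcal A): W>0\text{ a.s. on }E_+(Z)\}$. Ratios $Z/W$ are componentwise, and $\sup\emptyset=-\infty$. Then: (i) $\mathcal W(Z)\subset\mathcal E'_+$, $$\alpha(Z)=\sup_{W\in\mathcal W(Z)}\Big\{\sigma_{\mathcal A}(W)+\mathbb E\big[1_{\{W>0\}}\Lambda^\bullet(Z/W)\,W\big]\Big\},$$ and $\mathcal W(Z)\neq\emptyset$ whenever $\alpha(Z)>-\infty$. (ii) If $\operatorname{bar}(\mathcal A)\cap\mathcal E'_{++}\neq\emptyset$, then $\mathcal W(Z)\neq\emptyset$ and $$\alpha^+(Z)=\sup_{W\in\operatorname{bar}(\mathcal A)\cap\mathcal E'_{++}}\Big\{\sigma_{\mathcal A}(W)+\mathbb E\big[\Lambda^\bullet(Z/W)\,W\big]\Big\}.$$ -/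

import Mathlib

open MeasureTheory Filter Topology
open scoped ENNReal

noncomputable section

namespace SystemicRisk

variable {Ω : Type*} [MeasurableSpace Ω]

/-- `(L, ≤)`, with `≤` the almost-sure order inherited from `L⁰`, is a Banach lattice: any two
elements have a least upper bound in `L`, and there is a complete norm `p` on `L` which is monotone
in the absolute value `|X| = X ∨ (-X)`. -/
def IsBanachLattice {μ : Measure Ω} (L : Submodule ℝ (Ω →ₘ[μ] ℝ)) : Prop :=
  (∀ X Y : L, ∃ V : L, IsLUB {X, Y} V) ∧
  ∃ p : Seminorm ℝ L,
    (∀ X, p X = 0 → X = 0) ∧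
    (∀ X Y X' Y' : L, IsLUB {X, -X} X' → IsLUB {Y, -Y} Y' → X' ≤ Y' → p X ≤ p Y) ∧
    (∀ u : ℕ → L, (∀ ε > 0, ∃ N, ∀ m ≥ N, ∀ n ≥ N, p (u m - u n) < ε) →
      ∃ X : L, Tendsto (fun n => p (u n - X)) atTop (𝓝 0))

/-- Admissible subspaces of `L⁰`: Banach lattices `L` with `L^∞ ⊆ L ⊆ L¹`. -/
structure IsAdmissibleSpace {μ : Measure Ω} (L : Submodule ℝ (Ω →ₘ[μ] ℝ)) : Prop where
  banachLattice : IsBanachLattice L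
  bounded_mem : ∀ X : Ω →ₘ[μ] ℝ, MemLp X ∞ μ → X ∈ L
  integrable : ∀ X ∈ L, Integrable X μ

/-- The space `L' = {Z ∈ L⁰ ; 𝔼[|XZ|] < ∞ for all X ∈ L}`. -/
def dualSpace {μ : Measure Ω} (L : Submodule ℝ (Ω →ₘ[μ] ℝ)) : Submodule ℝ (Ω →ₘ[μ] ℝ) where
  carrier := {Z | ∀ X ∈ L, Integrable (fun ω => X ω * Z ω) μ}
  zero_mem' := fun X _ => by
    refine (integrable_zero Ω ℝ μ).congr ?_
    filter_upwards [AEEqFun.coeFn_zero (α := Ω) (β := ℝ) (μ := μ)] with ω h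
    simp [h]
  add_mem' := fun {Z Z'} hZ hZ' X hX => by
    refine ((hZ X hX).add (hZ' X hX)).congr ?_
    filter_upwards [AEEqFun.coeFn_add Z Z'] with ω h
    simp [h, mul_add]
  smul_mem' := fun c Z hZ X hX => by
    refine ((hZ X hX).const_mul c).congr ?_
    filter_upwards [AEEqFun.coeFn_smul c Z] with ω h
    simp [h, mul_left_comm]

/-- The random vectors with `i`-th component in `L i`, i.e. the space `L₁ × ⋯ × L_d`. -/
abbrev Vec {μ : Measure Ω} {d : ℕ} (L : Fin d → Submodule ℝ (Ω →ₘ[μ] ℝ)) : Type _ :=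
  (i : Fin d) → L i

/-- The space `L' = L₁' × ⋯ × L_d'`. -/
abbrev DualVec {μ : Measure Ω} {d : ℕ} (L : Fin d → Submodule ℝ (Ω →ₘ[μ] ℝ)) : Type _ :=
  (i : Fin d) → dualSpace (L i)

/-- `𝔼[U W]` for `U ∈ L`, `W ∈ L'`. -/
def pair {μ : Measure Ω} {L : Submodule ℝ (Ω →ₘ[μ] ℝ)} (U : L) (W : dualSpace L) : ℝ :=
  ∫ ω, (U : Ω →ₘ[μ] ℝ) ω * (W : Ω →ₘ[μ] ℝ) ω ∂μ

/-- `(X | Z) = 𝔼[⟨X, Z⟩] = ∑ᵢ 𝔼[Xᵢ Zᵢ]` for `X ∈ L`, `Z ∈ L'`. -/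
def vecPair {μ : Measure Ω} {d : ℕ} {L : Fin d → Submodule ℝ (Ω →ₘ[μ] ℝ)}
    (X : Vec L) (Z : DualVec L) : ℝ :=
  ∑ i, pair (X i) (Z i)

/-- The topology `σ(L, L')` on an admissible space of random variables. -/
@[reducible]
def weakTopology {μ : Measure Ω} (L : Submodule ℝ (Ω →ₘ[μ] ℝ)) : TopologicalSpace L :=
  ⨅ W : dualSpace L, TopologicalSpace.induced (fun U => pair U W) inferInstance

/-- The topology `σ(L, L')` on an admissible space of random vectors. -/
@[reducible]
def vecWeakTopology {μ : Measure Ω} {d : ℕ} (L : Fin d → Submodule ℝ (Ω →ₘ[μ] ℝ)) :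
    TopologicalSpace (Vec L) :=
  ⨅ Z : DualVec L, TopologicalSpace.induced (fun X => vecPair X Z) inferInstance

/-- Admissible impact maps `S : 𝒳 → ℰ`. -/
structure IsAdmissibleImpact {μ : Measure Ω} {d : ℕ} (𝒳 : Fin d → Submodule ℝ (Ω →ₘ[μ] ℝ))
    (ℰ : Submodule ℝ (Ω →ₘ[μ] ℝ)) (S : Vec 𝒳 → ℰ) : Prop where
  discrimination : ∃ X Y, S X ≠ S Y
  normalization : S 0 = 0
  monotonicity : ∀ X Y, Y ≤ X → S Y ≤ S X
  concavity : ∀ X Y, ∀ l : ℝ, 0 ≤ l → l ≤ 1 →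
    l • S X + (1 - l) • S Y ≤ S (l • X + (1 - l) • Y)
  semicontinuity : ∀ W : dualSpace ℰ, 0 ≤ W →
    @UpperSemicontinuous _ ℝ (vecWeakTopology 𝒳) _ (fun X => pair (S X) W)

/-- Admissible acceptance sets `𝒜 ⊆ ℰ` (relative to the impact map `S`). -/
structure IsAdmissibleAcceptance {μ : Measure Ω} {d : ℕ} (𝒳 : Fin d → Submodule ℝ (Ω →ₘ[μ] ℝ))
    (ℰ : Submodule ℝ (Ω →ₘ[μ] ℝ)) (S : Vec 𝒳 → ℰ) (𝒜 : Set ℰ) : Prop where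
  preimage_nonempty : (S ⁻¹' 𝒜).Nonempty
  preimage_proper : S ⁻¹' 𝒜 ≠ Set.univ
  normalization : 0 ∈ 𝒜
  monotonicity : ∀ U ∈ 𝒜, ∀ V : ℰ, 0 ≤ V → U + V ∈ 𝒜
  convexity : ∀ U ∈ 𝒜, ∀ V ∈ 𝒜, ∀ l : ℝ, 0 ≤ l → l ≤ 1 → l • U + (1 - l) • V ∈ 𝒜
  closedness : @IsClosed _ (weakTopology ℰ) 𝒜

/-- The lower support function `σ_𝒜(W) = inf_{U ∈ 𝒜} 𝔼[U W]`. -/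
def support {μ : Measure Ω} {ℰ : Submodule ℝ (Ω →ₘ[μ] ℝ)} (𝒜 : Set ℰ) (W : dualSpace ℰ) : EReal :=
  ⨅ U ∈ 𝒜, (pair U W : EReal)

/-- The barrier cone `bar(𝒜) = {W ∈ ℰ' ; σ_𝒜(W) > -∞}`. -/
def bar {μ : Measure Ω} {ℰ : Submodule ℝ (Ω →ₘ[μ] ℝ)} (𝒜 : Set ℰ) : Set (dualSpace ℰ) :=
  {W | ⊥ < support 𝒜 W}

/-- The set `L_{++}` of almost surely strictly positive elements of `L`. -/
def strictlyPositive {μ : Measure Ω} (L : Submodule ℝ (Ω →ₘ[μ] ℝ)) : Set L :=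
  {W | ∀ᵐ ω ∂μ, 0 < (W : Ω →ₘ[μ] ℝ) ω}

/-- `inf_{X ∈ 𝒳} {𝔼[⟨X, Z⟩] - 𝔼[S(X) W]}`. -/
def penaltyTerm {μ : Measure Ω} {d : ℕ} {𝒳 : Fin d → Submodule ℝ (Ω →ₘ[μ] ℝ)}
    {ℰ : Submodule ℝ (Ω →ₘ[μ] ℝ)} (S : Vec 𝒳 → ℰ) (Z : DualVec 𝒳) (W : dualSpace ℰ) : EReal :=
  ⨅ X : Vec 𝒳, ((vecPair X Z - pair (S X) W : ℝ) : EReal)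

/-- The map `α : 𝒳' → [-∞, ∞]`. -/
def alpha {μ : Measure Ω} {d : ℕ} {𝒳 : Fin d → Submodule ℝ (Ω →ₘ[μ] ℝ)}
    {ℰ : Submodule ℝ (Ω →ₘ[μ] ℝ)} (S : Vec 𝒳 → ℰ) (𝒜 : Set ℰ) (Z : DualVec 𝒳) : EReal :=
  ⨆ W ∈ bar 𝒜, (support 𝒜 W + penaltyTerm S Z W)

/-- The map `α⁺ : 𝒳' → [-∞, ∞]`. -/
def alphaPlus {μ : Measure Ω} {d : ℕ} {𝒳 : Fin d → Submodule ℝ (Ω →ₘ[μ] ℝ)}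
    {ℰ : Submodule ℝ (Ω →ₘ[μ] ℝ)} (S : Vec 𝒳 → ℰ) (𝒜 : Set ℰ) (Z : DualVec 𝒳) : EReal :=
  ⨆ W ∈ bar 𝒜 ∩ (strictlyPositive (dualSpace ℰ) ∪ {0}), (support 𝒜 W + penaltyTerm S Z W)

/-- The concave conjugate `Λ^•(z) = inf_{x ∈ ℝ^d} {⟨x, z⟩ - Λ(x)}`. -/
def concaveConj {d : ℕ} (Lam : (Fin d → ℝ) → ℝ) (z : Fin d → ℝ) : EReal :=
  ⨅ x : Fin d → ℝ, ((∑ i, x i * z i - Lam x : ℝ) : EReal)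

/-- Expectation of an extended-real function, `𝔼[f⁺] - 𝔼[f⁻]`. -/
def extExpectation (μ : Measure Ω) (f : Ω → EReal) : EReal :=
  ((∫⁻ ω, (f ω).toENNReal ∂μ : ℝ≥0∞) : EReal) - ((∫⁻ ω, (-f ω).toENNReal ∂μ : ℝ≥0∞) : EReal)

/-- The event `E₊(Z) = ⋃ᵢ {Zᵢ > 0}`. -/
def posEvent {μ : Measure Ω} {d : ℕ} {𝒳 : Fin d → Submodule ℝ (Ω →ₘ[μ] ℝ)} (Z : DualVec 𝒳) :
    Set Ω :=
  ⋃ i, {ω | 0 < (Z i : Ω →ₘ[μ] ℝ) ω}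

/-- The elements `W` of `bar(𝒜)` with `W > 0` almost surely on `E₊(Z)`. -/
def barPosOn {μ : Measure Ω} {d : ℕ} {𝒳 : Fin d → Submodule ℝ (Ω →ₘ[μ] ℝ)}
    {ℰ : Submodule ℝ (Ω →ₘ[μ] ℝ)} (𝒜 : Set ℰ) (Z : DualVec 𝒳) : Set (dualSpace ℰ) :=
  {W | W ∈ bar 𝒜 ∧ ∀ᵐ ω ∂μ, ω ∈ posEvent Z → 0 < (W : Ω →ₘ[μ] ℝ) ω}

/-- The random variable `Λ^•(Z / W) W`, the ratio being taken component by component. -/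
def conjTerm {μ : Measure Ω} {d : ℕ} {𝒳 : Fin d → Submodule ℝ (Ω →ₘ[μ] ℝ)}
    {ℰ : Submodule ℝ (Ω →ₘ[μ] ℝ)} (Lam : (Fin d → ℝ) → ℝ) (Z : DualVec 𝒳) (W : dualSpace ℰ)
    (ω : Ω) : EReal :=
  concaveConj Lam (fun i => (Z i : Ω →ₘ[μ] ℝ) ω / (W : Ω →ₘ[μ] ℝ) ω) *
    (((W : Ω →ₘ[μ] ℝ) ω : ℝ) : EReal)

end SystemicRisk

end

namespace SystemicRisk

/-! Since `S` acts pointwise through `Λ`, the inner infimum in `α(Z)` is the infimum over `X` of the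
expectation of the Lagrangian `⟨X, Z⟩ - Λ(X) W`. Everything rests on three facts.

Barrier elements are nonnegative, because `𝒜` contains all nonnegative elements
(`nonneg_of_mem_bar`). If `W` vanishes on a nonnull part `B` of some `{Z_i > 0}`, testing with `-t
1_B e_i` drives the infimum to `-∞` (`pos_on_posEvent_of_bot_lt_penaltyTerm`), so only `W` positive
on `E₊(Z)` contribute. For those `W`, infimum and expectation interchange
(`penaltyTerm_eq_extExpectation`): one inequality is pointwise. For the other, continuity of `Λ`
reduces the pointwise infimum to a dense sequence, minima over finitely many points are realised by
bounded measurable vectors, which lie in `𝒳`, and monotone convergence concludes.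

The pointwise infimum equals `Λ^•(Z/W) W` where `W > 0`, and `0` where `W = 0`, since `Z = 0` there.
In (ii) the extra candidate `W = 0` contributes `-∞` because `Z ≠ 0`. -/

/-- The integrand `⟨x, Z⟩ - Λ(x) W` at a point `x` of `ℝ^d`. -/
def lagrangian {Ω : Type*} {d : ℕ} (Lam : (Fin d → ℝ) → ℝ) (z : Fin d → Ω → ℝ) (w : Ω → ℝ)
    (x : Fin d → ℝ) (ω : Ω) : ℝ :=
  ∑ i, x i * z i ω - Lam x * w ω

/-- The infimum of the Lagrangian over `ℝ^d` is approached along any dense sequence. -/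
theorem toENNReal_neg_iInf_lagrangian_le {Ω : Type*} {d : ℕ} {Lam : (Fin d → ℝ) → ℝ} (hLam : Continuous Lam)
    (z : Fin d → Ω → ℝ) (w : Ω → ℝ) {u : ℕ → Fin d → ℝ} (hu : DenseRange u) (ω : Ω) :
    (-⨅ x, (lagrangian Lam z w x ω : EReal)).toENNReal ≤
      ⨆ n, ⨆ k, ⨆ _ : k < n, ENNReal.ofReal (-lagrangian Lam z w (u k) ω) := by
  set s : ℝ≥0∞ := ⨆ n, ⨆ k, ⨆ _ : k < n, ENNReal.ofReal (-lagrangian Lam z w (u k) ω) with hs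
  have hcont : Continuous fun x => ENNReal.ofReal (-lagrangian Lam z w x ω) := by
    unfold lagrangian
    exact ENNReal.continuous_ofReal.comp (by fun_prop)
  have hall : ∀ x, ENNReal.ofReal (-lagrangian Lam z w x ω) ≤ s := by
    intro x
    refine hu.induction_on (p := fun x => ENNReal.ofReal (-lagrangian Lam z w x ω) ≤ s) x
      (isClosed_le hcont continuous_const) fun k => ?_
    exact le_iSup_of_le (k + 1) (le_iSup₂_of_le k (Nat.lt_succ_self k) le_rfl)
  rw [← EReal.toENNReal_coe (x := s)]
  refine EReal.toENNReal_le_toENNReal (EReal.neg_le.1 (le_iInf fun x => ?_))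
  rw [EReal.neg_le, ← EReal.coe_neg]
  refine le_trans ?_ (EReal.coe_ennreal_le_coe_ennreal_iff.2 (hall x))
  rw [EReal.coe_ennreal_ofReal]
  exact EReal.coe_le_coe_iff.2 (le_max_left _ _)

section General

variable {Ω : Type*} [MeasurableSpace Ω] {μ : Measure Ω} {d : ℕ}

/-! ### Bounded test variables and positivity of multipliers -/

theorem IsAdmissibleSpace.exists_ae_eq {L : Submodule ℝ (Ω →ₘ[μ] ℝ)} (hL : IsAdmissibleSpace L)
    {f : Ω → ℝ} (hf : Measurable f) {C : ℝ} (hC : ∀ ω, |f ω| ≤ C) :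
    ∃ X : L, (X : Ω →ₘ[μ] ℝ) =ᵐ[μ] f := by
  have hm : MemLp f ∞ μ :=
    memLp_top_of_bound hf.aestronglyMeasurable C (Eventually.of_forall fun ω => by simpa using hC ω)
  have hmk := AEEqFun.coeFn_mk f hf.aestronglyMeasurable (μ := μ)
  exact ⟨⟨AEEqFun.mk f hf.aestronglyMeasurable, hL.bounded_mem _ ((memLp_congr_ae hmk).2 hm)⟩, hmk⟩

theorem coe_nonneg_iff {L : Submodule ℝ (Ω →ₘ[μ] ℝ)} {W : L} :
    0 ≤ W ↔ ∀ᵐ ω ∂μ, 0 ≤ (W : Ω →ₘ[μ] ℝ) ω := by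
  rw [← Subtype.coe_le_coe, ← AEEqFun.coeFn_le]
  have h0 := AEEqFun.coeFn_zero (α := Ω) (β := ℝ) (μ := μ)
  constructor
  · intro h
    filter_upwards [h, h0] with ω h h0
    simpa [h0] using h
  · intro h
    filter_upwards [h, h0] with ω h h0
    simpa [h0] using h

/-- An extended real above `⊥` is not bounded above by all nonpositive multiples of a positive
real. -/
theorem _root_.EReal.eq_bot_of_forall_le_neg_mul {a : EReal} {m : ℝ} (hm : 0 < m)
    (h : ∀ t : ℝ, 0 ≤ t → a ≤ ((-(t * m) : ℝ) : EReal)) : a = ⊥ := by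
  by_contra ha
  obtain ⟨r, -, hr⟩ := EReal.lt_iff_exists_real_btwn.1 (bot_lt_iff_ne_bot.2 ha)
  have h1 := hr.trans_le (h (|r| / m) (by positivity))
  rw [div_mul_cancel₀ _ hm.ne', EReal.coe_lt_coe_iff] at h1
  linarith [neg_abs_le r]

/-- With `V = 1_{W < 0}`, every `t V`, `t ≥ 0`, lies in `𝒜`, and pairing it with `W` gives `-t
E[W⁻]`; a finite lower bound forces `E[W⁻] = 0`. -/
theorem nonneg_of_mem_bar {ℰ : Submodule ℝ (Ω →ₘ[μ] ℝ)} (hℰ : IsAdmissibleSpace ℰ) {𝒜 : Set ℰ}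
    (h0 : 0 ∈ 𝒜) (hmono : ∀ U ∈ 𝒜, ∀ V : ℰ, 0 ≤ V → U + V ∈ 𝒜) {W : dualSpace ℰ}
    (hW : W ∈ bar 𝒜) : 0 ≤ W := by
  set w : Ω → ℝ := ⇑(W : Ω →ₘ[μ] ℝ) with hw
  have hwm : Measurable w := (W : Ω →ₘ[μ] ℝ).measurable
  have hB : MeasurableSet {ω | w ω < 0} := measurableSet_lt hwm measurable_const
  obtain ⟨V, hV⟩ := hℰ.exists_ae_eq (f := {ω | w ω < 0}.indicator 1)
    (measurable_one.indicator hB) (C := 1) (fun ω => by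
      by_cases h : w ω < 0 <;> simp [Set.indicator, h])
  have hprod : (fun ω => (V : Ω →ₘ[μ] ℝ) ω * w ω) =ᵐ[μ] fun ω => -max (-w ω) 0 := by
    filter_upwards [hV] with ω h
    rw [h]
    by_cases hn : w ω < 0
    · simp [Set.indicator, hn, hn.le]
    · simp [Set.indicator, hn, not_lt.1 hn]
  have hint : Integrable (fun ω => max (-w ω) 0) μ := by
    simpa using ((W.2 V V.2).congr hprod).neg
  have hV0 : 0 ≤ V := coe_nonneg_iff.2 <| by
    filter_upwards [hV] with ω h
    rw [h]
    exact Set.indicator_nonneg (fun _ _ => zero_le_one) _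
  have hm : ∫ ω, max (-w ω) 0 ∂μ = 0 := by
    by_contra hne
    have hpos : 0 < ∫ ω, max (-w ω) 0 ∂μ :=
      lt_of_le_of_ne (integral_nonneg fun ω => le_max_right _ _) (Ne.symm hne)
    refine (ne_of_gt hW) (EReal.eq_bot_of_forall_le_neg_mul hpos fun t ht => ?_)
    have htV : 0 ≤ t • V := coe_nonneg_iff.2 <| by
      filter_upwards [AEEqFun.coeFn_smul t (V : Ω →ₘ[μ] ℝ), coe_nonneg_iff.1 hV0] with ω h1 h2
      exact (mul_nonneg ht h2).trans_eq h1.symm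
    have hmem : t • V ∈ 𝒜 := by simpa using hmono 0 h0 (t • V) htV
    refine (iInf₂_le (t • V) hmem).trans (EReal.coe_le_coe_iff.2 (le_of_eq ?_))
    rw [pair, ← integral_const_mul, ← integral_neg]
    refine integral_congr_ae ?_
    filter_upwards [AEEqFun.coeFn_smul t (V : Ω →ₘ[μ] ℝ), hprod] with ω h1 h2
    have h3 : ((t • V : ℰ) : Ω →ₘ[μ] ℝ) ω = t * (V : Ω →ₘ[μ] ℝ) ω := h1
    rw [h3, mul_assoc, h2]
    ring
  have hnn : 0 ≤ fun ω => max (-w ω) 0 := fun ω => le_max_right _ _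
  rw [integral_eq_zero_iff_of_nonneg hnn hint] at hm
  refine coe_nonneg_iff.2 ?_
  filter_upwards [hm] with ω h
  have h' : max (-w ω) 0 = 0 := h
  have := le_max_left (-w ω) 0
  linarith

section Penalty

variable {𝒳 : Fin d → Submodule ℝ (Ω →ₘ[μ] ℝ)} {ℰ : Submodule ℝ (Ω →ₘ[μ] ℝ)} {S : Vec 𝒳 → ℰ}
  {Lam : (Fin d → ℝ) → ℝ}

theorem integrable_lagrangian_and_integral_eq
    (hSLam : ∀ X : Vec 𝒳,
      (S X : Ω →ₘ[μ] ℝ) =ᵐ[μ] fun ω => Lam (fun i => (X i : Ω →ₘ[μ] ℝ) ω))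
    (Z : DualVec 𝒳) (W : dualSpace ℰ) {X : Vec 𝒳} {f : Ω → Fin d → ℝ}
    (hX : ∀ i, (X i : Ω →ₘ[μ] ℝ) =ᵐ[μ] fun ω => f ω i) :
    Integrable (fun ω => lagrangian Lam (fun i => (Z i : Ω →ₘ[μ] ℝ)) (W : Ω →ₘ[μ] ℝ) (f ω) ω) μ ∧
      vecPair X Z - pair (S X) W =
        ∫ ω, lagrangian Lam (fun i => (Z i : Ω →ₘ[μ] ℝ)) (W : Ω →ₘ[μ] ℝ) (f ω) ω ∂μ := by
  have h1 : ∀ i, Integrable (fun ω => (X i : Ω →ₘ[μ] ℝ) ω * (Z i : Ω →ₘ[μ] ℝ) ω) μ :=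
    fun i => (Z i).2 _ (X i).2
  have h2 : Integrable (fun ω => (S X : Ω →ₘ[μ] ℝ) ω * (W : Ω →ₘ[μ] ℝ) ω) μ := W.2 _ (S X).2
  have hsum := integrable_finsetSum Finset.univ (fun i _ => h1 i)
  have hae : (fun ω => (∑ i, (X i : Ω →ₘ[μ] ℝ) ω * (Z i : Ω →ₘ[μ] ℝ) ω) -
      (S X : Ω →ₘ[μ] ℝ) ω * (W : Ω →ₘ[μ] ℝ) ω) =ᵐ[μ]
      fun ω => lagrangian Lam (fun i => (Z i : Ω →ₘ[μ] ℝ)) (W : Ω →ₘ[μ] ℝ) (f ω) ω := by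
    filter_upwards [hSLam X, ae_all_iff.2 hX] with ω hS hX
    simp only [lagrangian, hS, hX]
  refine ⟨(hsum.sub h2).congr hae, ?_⟩
  rw [← integral_congr_ae hae, integral_sub hsum h2, integral_finsetSum _ fun i _ => h1 i]
  rfl

/-- Bounded measurable vectors represent elements of `𝒳` because `L^∞ ⊆ 𝒳_i`, so they are legitimate
competitors in the infimum. -/
theorem penaltyTerm_le_of_bounded (h𝒳 : ∀ i, IsAdmissibleSpace (𝒳 i))
    (hSLam : ∀ X : Vec 𝒳,
      (S X : Ω →ₘ[μ] ℝ) =ᵐ[μ] fun ω => Lam (fun i => (X i : Ω →ₘ[μ] ℝ) ω))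
    (Z : DualVec 𝒳) (W : dualSpace ℰ) {f : Ω → Fin d → ℝ} (hf : Measurable f) {C : ℝ}
    (hC : ∀ ω i, |f ω i| ≤ C) :
    Integrable (fun ω => lagrangian Lam (fun i => (Z i : Ω →ₘ[μ] ℝ)) (W : Ω →ₘ[μ] ℝ) (f ω) ω) μ ∧
      penaltyTerm S Z W ≤
        ((∫ ω, lagrangian Lam (fun i => (Z i : Ω →ₘ[μ] ℝ)) (W : Ω →ₘ[μ] ℝ) (f ω) ω ∂μ : ℝ) :
          EReal) := by
  choose X hX using fun i => (h𝒳 i).exists_ae_eq (f := fun ω => f ω i)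
    ((measurable_pi_apply i).comp hf) (fun ω => hC ω i)
  obtain ⟨h1, h2⟩ := integrable_lagrangian_and_integral_eq hSLam Z W (X := X) hX
  exact ⟨h1, h2 ▸ iInf_le _ X⟩

/-- If the penalty term is finite, then `W > 0` almost surely on `E₊(Z)`. -/
theorem pos_on_posEvent_of_bot_lt_penaltyTerm (h𝒳 : ∀ i, IsAdmissibleSpace (𝒳 i))
    (hSLam : ∀ X : Vec 𝒳,
      (S X : Ω →ₘ[μ] ℝ) =ᵐ[μ] fun ω => Lam (fun i => (X i : Ω →ₘ[μ] ℝ) ω))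
    (hLam_zero : Lam 0 = 0) {Z : DualVec 𝒳} {W : dualSpace ℰ} (hW : 0 ≤ W)
    (h : ⊥ < penaltyTerm S Z W) :
    ∀ᵐ ω ∂μ, ω ∈ posEvent Z → 0 < (W : Ω →ₘ[μ] ℝ) ω := by
  set w : Ω → ℝ := ⇑(W : Ω →ₘ[μ] ℝ) with hw
  have hwm : Measurable w := (W : Ω →ₘ[μ] ℝ).measurable
  suffices hi : ∀ i, ∀ᵐ ω ∂μ, 0 < (Z i : Ω →ₘ[μ] ℝ) ω → 0 < w ω by
    filter_upwards [ae_all_iff.2 hi] with ω hω hpos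
    obtain ⟨i, hi⟩ := Set.mem_iUnion.1 hpos
    exact hω i hi
  intro i
  set z : Ω → ℝ := ⇑(Z i : Ω →ₘ[μ] ℝ) with hz
  have hzm : Measurable z := (Z i : Ω →ₘ[μ] ℝ).measurable
  set B : Set Ω := {ω | 0 < z ω ∧ w ω ≤ 0} with hBdef
  have hB : MeasurableSet B :=
    (measurableSet_lt measurable_const hzm).inter (measurableSet_le hwm measurable_const)
  have key : ∀ t : ℝ, Integrable (fun ω => -(t * B.indicator z ω)) μ ∧
      penaltyTerm S Z W ≤ ((∫ ω, -(t * B.indicator z ω) ∂μ : ℝ) : EReal) := by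
    intro t
    -- The competitor is `-t 1_B e_i`: on `B` the `Λ` term is killed by `W = 0`, off `B` by `Λ(0) =
    -- 0`.
    have hf : Measurable fun ω => (Pi.single i (-(t * B.indicator 1 ω)) : Fin d → ℝ) := by
      refine measurable_pi_lambda _ fun j => ?_
      rcases eq_or_ne j i with rfl | hj
      · simpa using (measurable_one.indicator hB).const_mul t
      · simp [Pi.single_eq_of_ne hj]
    obtain ⟨h1, h2⟩ := penaltyTerm_le_of_bounded h𝒳 hSLam Z W hf (C := |t|) (fun ω j => by
      rcases eq_or_ne j i with rfl | hj
      · by_cases hω : ω ∈ B <;> simp [hω]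
      · simp [Pi.single_eq_of_ne hj])
    have hae : (fun ω => lagrangian Lam (fun i => (Z i : Ω →ₘ[μ] ℝ)) (W : Ω →ₘ[μ] ℝ)
        (Pi.single i (-(t * B.indicator 1 ω)) : Fin d → ℝ) ω) =ᵐ[μ]
        fun ω => -(t * B.indicator z ω) := by
      filter_upwards [coe_nonneg_iff.1 hW] with ω hω
      have hsum : ∑ j, (Pi.single i (-(t * B.indicator 1 ω)) : Fin d → ℝ) j *
          (Z j : Ω →ₘ[μ] ℝ) ω = -(t * B.indicator 1 ω) * z ω := by
        rw [Finset.sum_eq_single i (fun j _ hj => by simp [Pi.single_eq_of_ne hj])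
          (fun hi => absurd (Finset.mem_univ i) hi), Pi.single_eq_same]
      rw [lagrangian, hsum]
      by_cases hωB : ω ∈ B
      · have hw0 : w ω = 0 := le_antisymm hωB.2 hω
        simp [hωB, ← hw, hw0]
      · simp [hωB, hLam_zero]
    exact ⟨h1.congr hae, (integral_congr_ae hae) ▸ h2⟩
  -- The choice `t = -1` turns `-(t 1_B Z_i)` into `1_B Z_i` itself.
  have hint : Integrable (B.indicator z) μ := by simpa using (key (-1)).1
  have hnn : ∀ ω, 0 ≤ B.indicator z ω := fun ω => Set.indicator_nonneg (fun _ hω => hω.1.le) ω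
  have hm : ∫ ω, B.indicator z ω ∂μ = 0 := by
    by_contra hne
    have hpos : 0 < ∫ ω, B.indicator z ω ∂μ := lt_of_le_of_ne (integral_nonneg hnn) (Ne.symm hne)
    refine (ne_of_gt h) (EReal.eq_bot_of_forall_le_neg_mul hpos fun t _ => ?_)
    have := (key t).2
    rwa [integral_neg, integral_const_mul] at this
  rw [integral_eq_zero_iff_of_nonneg hnn hint] at hm
  filter_upwards [hm] with ω hω hzpos
  by_contra hwn
  have hωB : ω ∈ B := ⟨hzpos, not_lt.1 hwn⟩
  have h0 : B.indicator z ω = 0 := hω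
  rw [Set.indicator_of_mem hωB] at h0
  exact hzpos.ne' h0

end Penalty

/-! ### Extended-real expectations and measurable selection -/

theorem _root_.EReal.iInf_coe_mul_coe {ι : Type*} (a : ι → ℝ) {c : ℝ} (hc : 0 < c) :
    (⨅ x, (a x : EReal)) * (c : EReal) = ⨅ x, ((a x * c : ℝ) : EReal) := by
  have hc' : (0 : EReal) < c := EReal.coe_pos.2 hc
  refine le_antisymm (le_iInf fun x => ?_) ?_
  · rw [EReal.coe_mul]
    exact mul_le_mul_of_nonneg_right (iInf_le _ x) hc'.le
  · rw [mul_comm, ← EReal.div_le_iff_le_mul hc' (EReal.coe_ne_top c)]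
    refine le_iInf fun x => ?_
    rw [EReal.div_le_iff_le_mul hc' (EReal.coe_ne_top c), mul_comm, ← EReal.coe_mul]
    exact iInf_le _ x

theorem extExpectation_congr {f g : Ω → EReal} (h : f =ᵐ[μ] g) :
    extExpectation μ f = extExpectation μ g := by
  have h1 : ∫⁻ ω, (f ω).toENNReal ∂μ = ∫⁻ ω, (g ω).toENNReal ∂μ :=
    lintegral_congr_ae (h.mono fun ω hω => by simp only [hω])
  have h2 : ∫⁻ ω, (-f ω).toENNReal ∂μ = ∫⁻ ω, (-g ω).toENNReal ∂μ :=
    lintegral_congr_ae (h.mono fun ω hω => by simp only [hω])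
  rw [extExpectation, extExpectation, h1, h2]

theorem extExpectation_of_nonpos {f : Ω → EReal} (h : ∀ᵐ ω ∂μ, f ω ≤ 0) :
    extExpectation μ f = -((∫⁻ ω, (-f ω).toENNReal ∂μ : ℝ≥0∞) : EReal) := by
  have h0 : ∫⁻ ω, (f ω).toENNReal ∂μ = 0 := by
    rw [lintegral_congr_ae (g := 0) (h.mono fun ω hω => EReal.toENNReal_of_nonpos hω)]
    simp
  rw [extExpectation, h0, EReal.coe_ennreal_zero, zero_sub]

/-- Only the negative part of `f` counts, and it dominates that of `g`; the positive part of `g`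
merely raises the right-hand side. Measurability of `f` is not needed, so an uncountable infimum can
be used as `f`. -/
theorem extExpectation_le_integral {f : Ω → EReal} {g : Ω → ℝ} (hg : Integrable g μ)
    (hf : ∀ᵐ ω ∂μ, f ω ≤ 0) (hfg : ∀ᵐ ω ∂μ, f ω ≤ g ω) :
    extExpectation μ f ≤ ((∫ ω, g ω ∂μ : ℝ) : EReal) := by
  rw [extExpectation_of_nonpos hf]
  have h1 : ∫⁻ ω, ENNReal.ofReal (-g ω) ∂μ ≤ ∫⁻ ω, (-f ω).toENNReal ∂μ := by
    refine lintegral_mono_ae ?_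
    filter_upwards [hfg] with ω h
    have hr : ENNReal.ofReal (-g ω) = (-(g ω : EReal)).toENNReal := by
      rw [← EReal.coe_neg, EReal.toENNReal_of_ne_top (EReal.coe_ne_top _), EReal.toReal_coe]
    exact hr ▸ EReal.toENNReal_le_toENNReal (EReal.neg_le_neg_iff.2 h)
  have hfin : ∫⁻ ω, ENNReal.ofReal (-g ω) ∂μ ≠ ∞ := hg.neg.lintegral_lt_top.ne
  calc -((∫⁻ ω, (-f ω).toENNReal ∂μ : ℝ≥0∞) : EReal)
      ≤ -((∫⁻ ω, ENNReal.ofReal (-g ω) ∂μ : ℝ≥0∞) : EReal) :=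
        EReal.neg_le_neg_iff.2 (EReal.coe_ennreal_le_coe_ennreal_iff.2 h1)
    _ = ((-(∫⁻ ω, ENNReal.ofReal (-g ω) ∂μ).toReal : ℝ) : EReal) := by
        rw [EReal.coe_neg, EReal.coe_ennreal_toReal hfin]
    _ ≤ ((∫ ω, g ω ∂μ : ℝ) : EReal) := by
        rw [integral_eq_lintegral_pos_part_sub_lintegral_neg_part hg, EReal.coe_le_coe_iff]
        linarith [ENNReal.toReal_nonneg (a := ∫⁻ ω, ENNReal.ofReal (g ω) ∂μ)]

theorem coe_lintegral_ofReal_neg {g : Ω → ℝ} (hg : Integrable g μ) (h : ∀ ω, g ω ≤ 0) :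
    ((∫⁻ ω, ENNReal.ofReal (-g ω) ∂μ : ℝ≥0∞) : EReal) = -((∫ ω, g ω ∂μ : ℝ) : EReal) := by
  have hi := ofReal_integral_eq_lintegral_ofReal hg.neg
    (Eventually.of_forall fun ω => neg_nonneg.2 (h ω))
  simp only [Pi.neg_apply] at hi
  rw [← hi, EReal.coe_ennreal_ofReal,
    max_eq_left (integral_nonneg fun ω => neg_nonneg.2 (h ω)), integral_neg, EReal.coe_neg]

theorem measurable_lagrangian {Lam : (Fin d → ℝ) → ℝ} (hLam : Measurable Lam)
    {z : Fin d → Ω → ℝ} (hz : ∀ i, Measurable (z i)) {w : Ω → ℝ} (hw : Measurable w)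
    {f : Ω → Fin d → ℝ} (hf : Measurable f) :
    Measurable fun ω => lagrangian Lam z w (f ω) ω := by
  unfold lagrangian
  refine (Finset.measurable_sum _ fun i _ =>
    ((measurable_pi_apply i).comp hf).mul (hz i)).sub ((hLam.comp hf).mul hw)

/-- Bounded measurable selection of a minimiser of the Lagrangian among finitely many points. -/
theorem exists_bounded_selection {Lam : (Fin d → ℝ) → ℝ} (hLam : Measurable Lam)
    (hLam_zero : Lam 0 = 0)
    {z : Fin d → Ω → ℝ} (hz : ∀ i, Measurable (z i)) {w : Ω → ℝ} (hw : Measurable w)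
    (u : ℕ → Fin d → ℝ) (n : ℕ) :
    ∃ f : Ω → Fin d → ℝ, Measurable f ∧ (∃ C, ∀ ω i, |f ω i| ≤ C) ∧
      (∀ ω, lagrangian Lam z w (f ω) ω ≤ 0) ∧
      ∀ ω, ∀ k < n, lagrangian Lam z w (f ω) ω ≤ lagrangian Lam z w (u k) ω := by
  induction n with
  | zero =>
    -- Starting from the zero vector keeps the Lagrangian nonpositive throughout, as `Λ(0) = 0`.
    exact ⟨0, measurable_zero, ⟨0, by simp⟩, by simp [lagrangian, hLam_zero], by simp⟩
  | succ n ih =>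
    classical
    obtain ⟨f, hf, ⟨C, hC⟩, h0, hmin⟩ := ih
    have hB : MeasurableSet {ω | lagrangian Lam z w (u n) ω < lagrangian Lam z w (f ω) ω} :=
      measurableSet_lt (measurable_lagrangian hLam hz hw measurable_const)
        (measurable_lagrangian hLam hz hw hf)
    refine ⟨fun ω => if lagrangian Lam z w (u n) ω < lagrangian Lam z w (f ω) ω then u n else f ω,
      Measurable.ite hB measurable_const hf, ⟨max C ‖u n‖, fun ω i => ?_⟩, fun ω => ?_,
      fun ω k hk => ?_⟩
    · dsimp only
      split_ifs
      · exact le_max_of_le_right (norm_le_pi_norm (u n) i)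
      · exact le_max_of_le_left (hC ω i)
    · dsimp only
      split_ifs with h
      · exact h.le.trans (h0 ω)
      · exact h0 ω
    · dsimp only
      rcases Nat.lt_succ_iff_lt_or_eq.1 hk with hk | rfl
      · split_ifs with h
        · exact h.le.trans (hmin ω k hk)
        · exact hmin ω k hk
      · split_ifs with h
        · exact le_rfl
        · exact not_lt.1 h

/-! ### Interchange of infimum and expectation -/

section Penalty

variable {𝒳 : Fin d → Submodule ℝ (Ω →ₘ[μ] ℝ)} {ℰ : Submodule ℝ (Ω →ₘ[μ] ℝ)} {S : Vec 𝒳 → ℰ}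
  {Lam : (Fin d → ℝ) → ℝ}

theorem indicator_conjTerm_ae_eq {Z : DualVec 𝒳} (hZ : 0 ≤ Z)
    {W : dualSpace ℰ} (hW : 0 ≤ W)
    (hpos : ∀ᵐ ω ∂μ, ω ∈ posEvent Z → 0 < (W : Ω →ₘ[μ] ℝ) ω) :
    {ω | 0 < (W : Ω →ₘ[μ] ℝ) ω}.indicator (conjTerm Lam Z W) =ᵐ[μ] fun ω =>
      ⨅ x : Fin d → ℝ, (lagrangian Lam (fun i => (Z i : Ω →ₘ[μ] ℝ)) (W : Ω →ₘ[μ] ℝ) x ω : EReal) := by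
  filter_upwards [hpos, coe_nonneg_iff.1 hW, ae_all_iff.2 fun i => coe_nonneg_iff.1 (hZ i)]
    with ω hpos hW hZ
  by_cases hw : 0 < (W : Ω →ₘ[μ] ℝ) ω
  · rw [Set.indicator_of_mem (by exact hw), conjTerm, concaveConj, EReal.iInf_coe_mul_coe _ hw]
    refine iInf_congr fun x => ?_
    have hsum : (∑ i, x i * ((Z i : Ω →ₘ[μ] ℝ) ω / (W : Ω →ₘ[μ] ℝ) ω)) * (W : Ω →ₘ[μ] ℝ) ω =
        ∑ i, x i * (Z i : Ω →ₘ[μ] ℝ) ω := by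
      rw [Finset.sum_mul]
      exact Finset.sum_congr rfl fun i _ => by field_simp
    rw [lagrangian, sub_mul, hsum]
  -- Where `W = 0`, also `Z = 0`, so the Lagrangian vanishes identically and its infimum matches the
  -- indicator's `0`.
  · rw [Set.indicator_of_notMem (by exact hw)]
    have hw0 : (W : Ω →ₘ[μ] ℝ) ω = 0 := le_antisymm (not_lt.1 hw) hW
    have hz0 : ∀ i, (Z i : Ω →ₘ[μ] ℝ) ω = 0 := fun i =>
      le_antisymm (not_lt.1 fun hi => hw (hpos (Set.mem_iUnion.2 ⟨i, hi⟩))) (hZ i)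
    simp [lagrangian, hw0, hz0]

/-- The infimum defining the penalty term can be taken inside the expectation. -/
theorem penaltyTerm_eq_extExpectation (h𝒳 : ∀ i, IsAdmissibleSpace (𝒳 i))
    (hSLam : ∀ X : Vec 𝒳,
      (S X : Ω →ₘ[μ] ℝ) =ᵐ[μ] fun ω => Lam (fun i => (X i : Ω →ₘ[μ] ℝ) ω))
    (hLam : Continuous Lam) (hLam_zero : Lam 0 = 0) {Z : DualVec 𝒳} (hZ : 0 ≤ Z)
    {W : dualSpace ℰ} (hW : 0 ≤ W)
    (hpos : ∀ᵐ ω ∂μ, ω ∈ posEvent Z → 0 < (W : Ω →ₘ[μ] ℝ) ω) :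
    penaltyTerm S Z W =
      extExpectation μ ({ω | 0 < (W : Ω →ₘ[μ] ℝ) ω}.indicator (conjTerm Lam Z W)) := by
  rw [extExpectation_congr (indicator_conjTerm_ae_eq hZ hW hpos)]
  set z : Fin d → Ω → ℝ := fun i => ⇑(Z i : Ω →ₘ[μ] ℝ) with hz
  set w : Ω → ℝ := ⇑(W : Ω →ₘ[μ] ℝ) with hw
  have hzm : ∀ i, Measurable (z i) := fun i => (Z i : Ω →ₘ[μ] ℝ).measurable
  have hwm : Measurable w := (W : Ω →ₘ[μ] ℝ).measurable
  have hnonpos : ∀ ω, ⨅ x, (lagrangian Lam z w x ω : EReal) ≤ 0 := fun ω =>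
    (iInf_le _ 0).trans (by simp [lagrangian, hLam_zero])
  refine le_antisymm ?_ (le_iInf fun X => ?_)
  · rw [extExpectation_of_nonpos (Eventually.of_forall hnonpos)]
    obtain ⟨u, hu⟩ := TopologicalSpace.exists_dense_seq (Fin d → ℝ)
    set φ : ℕ → Ω → ℝ≥0∞ :=
      fun n ω => ⨆ k, ⨆ _ : k < n, ENNReal.ofReal (-lagrangian Lam z w (u k) ω) with hφ
    have hφm : ∀ n, Measurable (φ n) := fun n =>
      Measurable.iSup fun k => Measurable.iSup fun _ =>
        (measurable_lagrangian hLam.measurable hzm hwm measurable_const).neg.ennreal_ofReal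
    have hφmono : Monotone φ := fun m n hmn ω =>
      iSup_mono fun k => iSup_mono' fun hk => ⟨hk.trans_le hmn, le_rfl⟩
    have hstep : ∀ n, ((∫⁻ ω, φ n ω ∂μ : ℝ≥0∞) : EReal) ≤ -penaltyTerm S Z W := by
      intro n
      obtain ⟨f, hf, ⟨C, hC⟩, h0, hmin⟩ :=
        exists_bounded_selection hLam.measurable hLam_zero hzm hwm u n
      obtain ⟨hint, hle⟩ := penaltyTerm_le_of_bounded h𝒳 hSLam Z W hf hC
      refine le_trans ?_ (EReal.neg_le_neg_iff.2 hle)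
      rw [← coe_lintegral_ofReal_neg hint h0, EReal.coe_ennreal_le_coe_ennreal_iff]
      exact lintegral_mono fun ω => iSup₂_le fun k hk =>
        ENNReal.ofReal_le_ofReal (neg_le_neg (hmin ω k hk))
    -- Nonnegativity is what lets `toENNReal` be undone below.
    have hp : 0 ≤ -penaltyTerm S Z W := (EReal.coe_ennreal_nonneg _).trans (hstep 0)
    rw [EReal.le_neg]
    calc ((∫⁻ ω, (-⨅ x, (lagrangian Lam z w x ω : EReal)).toENNReal ∂μ : ℝ≥0∞) : EReal)
        ≤ ((∫⁻ ω, ⨆ n, φ n ω ∂μ : ℝ≥0∞) : EReal) :=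
          EReal.coe_ennreal_le_coe_ennreal_iff.2 <| lintegral_mono fun ω =>
            toENNReal_neg_iInf_lagrangian_le hLam z w hu ω
      _ = ((⨆ n, ∫⁻ ω, φ n ω ∂μ : ℝ≥0∞) : EReal) := by rw [lintegral_iSup hφm hφmono]
      _ ≤ (((-penaltyTerm S Z W).toENNReal : ℝ≥0∞) : EReal) := by
          refine EReal.coe_ennreal_le_coe_ennreal_iff.2 (iSup_le fun n => ?_)
          rw [← EReal.coe_ennreal_le_coe_ennreal_iff, EReal.coe_toENNReal hp]
          exact hstep n
      _ = -penaltyTerm S Z W := EReal.coe_toENNReal hp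
  · obtain ⟨hint, heq⟩ := integrable_lagrangian_and_integral_eq hSLam Z W (X := X)
      (f := fun ω i => (X i : Ω →ₘ[μ] ℝ) ω) (fun i => Filter.EventuallyEq.rfl)
    rw [heq]
    exact extExpectation_le_integral hint (Eventually.of_forall hnonpos)
      (Eventually.of_forall fun ω => iInf_le _ _)

end Penalty

end General

end SystemicRisk

/-! ### Assembly of the two representations -/

theorem mainTheorem7 {Ω : Type*} [MeasurableSpace Ω] (μ : MeasureTheory.Measure Ω)
    [MeasureTheory.IsProbabilityMeasure μ] {d : ℕ}
    (𝒳 : Fin d → Submodule ℝ (Ω →ₘ[μ] ℝ)) (h𝒳 : ∀ i, SystemicRisk.IsAdmissibleSpace (𝒳 i))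
    (ℰ : Submodule ℝ (Ω →ₘ[μ] ℝ)) (hℰ : SystemicRisk.IsAdmissibleSpace ℰ)
    (S : SystemicRisk.Vec 𝒳 → ℰ) (hS : SystemicRisk.IsAdmissibleImpact 𝒳 ℰ S)
    (𝒜 : Set ℰ) (h𝒜 : SystemicRisk.IsAdmissibleAcceptance 𝒳 ℰ S 𝒜)
    (hind : ∀ X : SystemicRisk.Vec 𝒳, ∀ B : Set Ω, MeasurableSet B →
      ∃ Y : SystemicRisk.Vec 𝒳, ∀ i,
        (Y i : Ω →ₘ[μ] ℝ) =ᵐ[μ] B.indicator (X i : Ω →ₘ[μ] ℝ))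
    (Lam : (Fin d → ℝ) → ℝ) (hLam_nonconst : ∃ x y, Lam x ≠ Lam y) (hLam_mono : Monotone Lam)
    (hLam_conc : ConcaveOn ℝ Set.univ Lam) (hLam_zero : Lam 0 = 0)
    (hSLam : ∀ X : SystemicRisk.Vec 𝒳,
      (S X : Ω →ₘ[μ] ℝ) =ᵐ[μ] fun ω => Lam (fun i => (X i : Ω →ₘ[μ] ℝ) ω))
    (Z : SystemicRisk.DualVec 𝒳) (hZ_nonneg : 0 ≤ Z) (hZ_ne : Z ≠ 0) :
    (SystemicRisk.alpha S 𝒜 Z =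
        ⨆ W ∈ SystemicRisk.barPosOn 𝒜 Z,
          (SystemicRisk.support 𝒜 W +
            SystemicRisk.extExpectation μ
              ({ω | 0 < (W : Ω →ₘ[μ] ℝ) ω}.indicator (SystemicRisk.conjTerm Lam Z W))) ∧
      (∀ W ∈ SystemicRisk.barPosOn 𝒜 Z, 0 ≤ W) ∧
      (⊥ < SystemicRisk.alpha S 𝒜 Z → (SystemicRisk.barPosOn 𝒜 Z).Nonempty)) ∧
    ((SystemicRisk.bar 𝒜 ∩
          SystemicRisk.strictlyPositive (SystemicRisk.dualSpace ℰ)).Nonempty →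
      (SystemicRisk.barPosOn 𝒜 Z).Nonempty ∧
      SystemicRisk.alphaPlus S 𝒜 Z =
        ⨆ W ∈ SystemicRisk.bar 𝒜 ∩
            SystemicRisk.strictlyPositive (SystemicRisk.dualSpace ℰ),
          (SystemicRisk.support 𝒜 W +
            SystemicRisk.extExpectation μ (SystemicRisk.conjTerm Lam Z W))) := by
  have hLam_cont : Continuous Lam :=
    continuousOn_univ.1 (hLam_conc.continuousOn isOpen_univ)
  have hbar : ∀ {W}, W ∈ SystemicRisk.bar 𝒜 → 0 ≤ W := fun hW =>
    SystemicRisk.nonneg_of_mem_bar hℰ h𝒜.normalization h𝒜.monotonicity hW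
  have hval : ∀ {W}, W ∈ SystemicRisk.barPosOn 𝒜 Z → SystemicRisk.penaltyTerm S Z W =
      SystemicRisk.extExpectation μ
        ({ω | 0 < (W : Ω →ₘ[μ] ℝ) ω}.indicator (SystemicRisk.conjTerm Lam Z W)) := fun hW =>
    SystemicRisk.penaltyTerm_eq_extExpectation h𝒳 hSLam hLam_cont hLam_zero hZ_nonneg
      (hbar hW.1) hW.2
  have hmem : ∀ {W}, W ∈ SystemicRisk.bar 𝒜 → W ∉ SystemicRisk.barPosOn 𝒜 Z →
      SystemicRisk.support 𝒜 W + SystemicRisk.penaltyTerm S Z W = ⊥ := by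
    intro W hW hnot
    have h : SystemicRisk.penaltyTerm S Z W = ⊥ := by
      by_contra hne
      exact hnot ⟨hW, SystemicRisk.pos_on_posEvent_of_bot_lt_penaltyTerm h𝒳 hSLam hLam_zero
        (hbar hW) (bot_lt_iff_ne_bot.2 hne)⟩
    -- In `EReal`, `⊥` absorbs every summand, so nothing about the support value is needed.
    rw [h, EReal.add_bot]
  have hstrict : ∀ {W}, W ∈ SystemicRisk.bar 𝒜 ∩
      SystemicRisk.strictlyPositive (SystemicRisk.dualSpace ℰ) →
      W ∈ SystemicRisk.barPosOn 𝒜 Z := fun hW =>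
    ⟨hW.1, Filter.Eventually.mono hW.2 fun _ h _ => h⟩
  -- Otherwise `E₊(Z)` would be null, and `Z ≥ 0` would give `Z = 0`.
  have hzero : (0 : SystemicRisk.dualSpace ℰ) ∉ SystemicRisk.barPosOn 𝒜 Z := by
    rintro ⟨-, h⟩
    refine hZ_ne (funext fun i => Subtype.ext (AEEqFun.ext ?_))
    filter_upwards [h, AEEqFun.coeFn_zero (α := Ω) (β := ℝ) (μ := μ),
      SystemicRisk.coe_nonneg_iff.1 (hZ_nonneg i)] with ω h h0 hnn
    have h1 : ((0 : SystemicRisk.dualSpace (𝒳 i)) : Ω →ₘ[μ] ℝ) ω = 0 := h0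
    have h2 : ((0 : SystemicRisk.dualSpace ℰ) : Ω →ₘ[μ] ℝ) ω = 0 := h0
    refine Eq.trans (le_antisymm (not_lt.1 fun hpos => ?_) hnn) h1.symm
    exact absurd (h (Set.mem_iUnion.2 ⟨i, hpos⟩)) (by rw [h2]; exact lt_irrefl _)
  refine ⟨⟨?_, fun W hW => hbar hW.1, fun hα => ?_⟩, fun hne => ⟨hne.mono fun W => hstrict, ?_⟩⟩
  · refine le_antisymm (iSup₂_le fun W hW => ?_) (iSup₂_le fun W hW => ?_)
    · by_cases h : W ∈ SystemicRisk.barPosOn 𝒜 Z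
      · exact le_iSup₂_of_le W h (by rw [hval h])
      · exact (hmem hW h).trans_le bot_le
    · exact le_iSup₂_of_le W hW.1 (by rw [hval hW])
  · by_contra hempty
    rw [Set.not_nonempty_iff_eq_empty] at hempty
    refine hα.ne' (le_bot_iff.1 (iSup₂_le fun W hW => (hmem hW ?_).le))
    simp [hempty]
  · have hval' : ∀ {W}, W ∈ SystemicRisk.bar 𝒜 ∩
        SystemicRisk.strictlyPositive (SystemicRisk.dualSpace ℰ) →
        SystemicRisk.penaltyTerm S Z W =
          SystemicRisk.extExpectation μ (SystemicRisk.conjTerm Lam Z W) := by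
      intro W hW
      rw [hval (hstrict hW)]
      exact SystemicRisk.extExpectation_congr
        (Filter.Eventually.mono hW.2 fun ω hω => Set.indicator_of_mem (by exact hω) _)
    refine le_antisymm (iSup₂_le fun W hW => ?_) (iSup₂_le fun W hW => ?_)
    · rcases hW with ⟨hWbar, hW | rfl⟩
      · exact le_iSup₂_of_le W ⟨hWbar, hW⟩ (by rw [hval' ⟨hWbar, hW⟩])
      · exact (hmem hWbar hzero).trans_le bot_le
    · exact le_iSup₂_of_le W ⟨hW.1, Or.inl hW.2⟩ (by rw [hval' hW])
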